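/- Let $\mathsf A$ be an arbitrary (possibly non-unital) $C^*$-algebra, let $X$ be a (right) Hilbert $\mathsf A$-module, with $\mathsf A$-valued inner product linear in the second variable, and let $M(X)=\mathbb B(\mathsf A,X)$ be its multiplier module, where $\mathbb B(\cdot,\cdot)$ denotes adjointable operators. We regard $X$ as a submodule of $M(X)$ by identifying $x\in X$ with the operator $a\mapsto xa$. For $v\in M(X)$ and $z\in X$ put $\langle v,z\rangle=v^*z\in\mathsf A$, $\langle z,v\rangle=\langle v,z\rangle^*$, and write $va=v(a)\in X$ for $a\in\mathsf A$. Let $\ell^2(\mathsf A)$ be the Hilbert $\mathsf A$-module of all sequences $(a_n)_{n\in\mathbb N}$ in $\mathsf A$ for which $\sum_n a_n^*a_n$ converges in norm, with $\langle (a_n)_n,(b_n)_n\rangle=\sum_n a_n^*b_n$. A sequence $(v_n)_{n\in\mathbb N}$ in $M(X)$ is called a frame for $X$ (if all $v_n$ lie in $X$) or an outer frame for $X$ (if some $v_n$ does not lie in $X$) when there are constants $c,d>0$ such that for every $z\in X$ the series $\sum_n\langle z,v_n\rangle\langle v_n,z\rangle$ converges in norm and $$c\,\langle z,z\rangle\le\sum_{n}\langle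 z,v_n\rangle\langle v_n,z\rangle\le d\,\langle z,z\rangle .$$ Its analysis operator is $U:X\to\ell^2(\mathsf A)$, $Uz=(\langle v_n,z\rangle)_n$. A frame or outer frame $(y_n)_n$ for $X$ is dual to a frame or outer frame $(x_n)_n$ for $X$ if $\sum_n y_n\langle x_n,z\rangle=z$ in norm for all $z\in X$. **Theorem.** Let $(x_n)_n$ be a frame or an outer frame for $X$ with analysis operator $U$. Then $U$ is adjointable, $U^*U$ is invertible in $\mathbb B(X)$, and an operator $V\in\mathbb B(X,\ell^2(\mathsf A))$ is the analysis operator of a frame or an outer frame dual to $(x_n)_n$ if and only if $V$ is of the form $$V=F^*U(U^*U)^{-1},$$ where $F\in\mathbb B(\ell^2(\mathsf A))$ is an oblique projection to the range $R(U)$ along some closed direct complement of $R(U)$ in $\ell^2(\mathsf A)$; that is, there is a closed submodule $N$ of $\ell^2(\mathsf A)$ with $\ell^2(\mathsf A)=R(U)\dotplus N$ (direct, not necessarily orthogonal), $Fw=w$ for $w\in R(U)$ and $Fw=0$ for $w\in N$. -/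

import Mathlib

open Filter Topology MulOpposite

namespace ModularFrame

/-! ### Hilbert C*-modules

`CStarModule B X` of Mathlib is linear over `B` from the left.  A (right) Hilbert `A`-module is
therefore a complete `X` with `[CStarModule Aᵐᵒᵖ X]`: the element `x a` is `op a • x`, and the
`A`-valued inner product is the underlying element of `inner Aᵐᵒᵖ x y`. -/

section Basic

variable {A : Type*} [NonUnitalCStarAlgebra A] [PartialOrder A]
variable {X : Type*} [NormedAddCommGroup X] [NormedSpace ℂ X] [SMul Aᵐᵒᵖ X] [CStarModule Aᵐᵒᵖ X]

/-- The `A`-valued inner product `⟨x, y⟩` of a right Hilbert `A`-module, linear in `y`. -/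
def ip (A : Type*) [NonUnitalCStarAlgebra A] [PartialOrder A]
    {X : Type*} [NormedAddCommGroup X] [NormedSpace ℂ X] [SMul Aᵐᵒᵖ X] [CStarModule Aᵐᵒᵖ X]
    (x y : X) : A :=
  unop (inner Aᵐᵒᵖ x y)

theorem ip_smul_right (x y : X) (a : A) : ip A x (op a • y) = ip A x y * a := by
  simp [ip]

theorem ip_smul_left (x y : X) (a : A) : ip A (op a • x) y = star a * ip A x y := by
  simp [ip]

theorem star_ip (x y : X) : star (ip A x y) = ip A y x := by
  rw [ip, ip, ← unop_star, CStarModule.star_inner]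

theorem ip_add_right (x y z : X) : ip A x (y + z) = ip A x y + ip A x z := by
  simp [ip]

theorem ip_csmul_right (x y : X) (c : ℂ) : ip A x (c • y) = c • ip A x y := by
  simp [ip]

theorem ip_sub_right (x y z : X) : ip A x (y - z) = ip A x y - ip A x z := by
  simp [ip]

theorem norm_sq_eq_ip (x : X) : ‖x‖ ^ 2 = ‖ip A x x‖ := by
  rw [CStarModule.norm_sq_eq Aᵐᵒᵖ, ip, norm_unop]

theorem ext_ip {x y : X} (h : ∀ z : X, ip A z x = ip A z y) : x = y := by
  have h0 : ip A (x - y) (x - y) = 0 := by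
    rw [ip_sub_right, h, sub_self]
  have h1 : inner Aᵐᵒᵖ (x - y) (x - y) = 0 := by
    apply unop_injective
    simpa [ip] using h0
  exact sub_eq_zero.1 (CStarModule.inner_self.1 h1)

end Basic

/-! ### The C*-algebra as a right Hilbert module over itself -/

section Self

variable {A : Type*} [NonUnitalCStarAlgebra A] [PartialOrder A] [StarOrderedRing A]

/-- `A` as a right Hilbert `A`-module: `⟨a, b⟩ = a* b`. -/
instance instSelf : CStarModule Aᵐᵒᵖ A where
  inner a b := op (star a * b)
  inner_add_right := by simp [mul_add]
  inner_self_nonneg {x} := by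
    change 0 ≤ unop (op (star x * x))
    exact star_mul_self_nonneg x
  inner_self {x} := by
    rw [op_eq_zero_iff, CStarRing.star_mul_self_eq_zero_iff]
  inner_op_smul_right {a x y} := by
    apply unop_injective
    simp [mul_assoc, MulOpposite.smul_eq_mul_unop]
  inner_smul_right_complex := by simp [mul_smul_comm]
  star_inner x y := by
    apply unop_injective
    simp
  norm_eq_sqrt_norm_inner_self x := by
    rw [norm_op, CStarRing.norm_star_mul_self, Real.sqrt_mul_self (norm_nonneg x)]

theorem ip_self (a b : A) : ip A a b = star a * b := rfl

end Self

/-! ### The standard Hilbert module `ℓ²(A)` -/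

section EllTwo

variable {A : Type*} [NonUnitalCStarAlgebra A] [PartialOrder A] [StarOrderedRing A]

theorem summable_of_le {f g : ℕ → A} (h0 : ∀ n, 0 ≤ f n) (hfg : ∀ n, f n ≤ g n)
    (hg : Summable g) : Summable f := by
  rw [summable_iff_vanishing_norm] at hg ⊢
  intro ε hε
  obtain ⟨s, hs⟩ := hg ε hε
  refine ⟨s, fun t ht => lt_of_le_of_lt ?_ (hs t ht)⟩
  exact CStarAlgebra.norm_le_norm_of_nonneg_of_le (Finset.sum_nonneg fun i _ => h0 i)
    (Finset.sum_le_sum fun i _ => hfg i)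

/-- For a series of positive elements, convergence of the partial sums in norm is the same as
unconditional summability. -/
theorem summable_iff_tendsto {f : ℕ → A} (h0 : ∀ n, 0 ≤ f n) :
    Summable f ↔ ∃ s, Tendsto (fun N => ∑ n ∈ Finset.range N, f n) atTop (𝓝 s) := by
  refine ⟨fun h => ⟨_, h.hasSum.tendsto_sum_nat⟩, ?_⟩
  rintro ⟨s, hs⟩
  rw [summable_iff_vanishing_norm]
  intro ε hε
  obtain ⟨N, hN⟩ := Metric.cauchySeq_iff'.1 hs.cauchySeq ε hε
  refine ⟨Finset.range N, fun t ht => ?_⟩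
  obtain ⟨M, hM⟩ : ∃ M, t ⊆ Finset.range M := t.exists_nat_subset_range
  have hsub : t ⊆ Finset.range (max M N) \ Finset.range N := by
    intro i hi
    rw [Finset.mem_sdiff]
    refine ⟨?_, Finset.disjoint_left.1 ht hi⟩
    have := Finset.mem_range.1 (hM hi)
    exact Finset.mem_range.2 (lt_of_lt_of_le this (le_max_left _ _))
  have h1 := hN (max M N) (le_max_right _ _)
  rw [dist_eq_norm, ← Finset.sum_sdiff_eq_sub
    (Finset.range_subset_range.2 (le_max_right M N))] at h1
  refine lt_of_le_of_lt ?_ h1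
  exact CStarAlgebra.norm_le_norm_of_nonneg_of_le (Finset.sum_nonneg fun i _ => h0 i)
    (Finset.sum_le_sum_of_subset_of_nonneg hsub fun i _ _ => h0 i)

theorem star_add_mul_add_le (a b : A) :
    star (a + b) * (a + b) ≤ (2 : ℂ) • (star a * a) + (2 : ℂ) • (star b * b) := by
  have h : (2 : ℂ) • (star a * a) + (2 : ℂ) • (star b * b) - star (a + b) * (a + b)
      = star (a - b) * (a - b) := by
    rw [two_smul, two_smul, star_add, star_sub]
    noncomm_ring
  rw [← sub_nonneg, h]
  exact star_mul_self_nonneg _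

/-- The space of sequences `(aₙ)` in `A` for which `∑ aₙ* aₙ` converges in norm. -/
def ellTwoSubmodule (A : Type*) [NonUnitalCStarAlgebra A] [PartialOrder A] [StarOrderedRing A] :
    Submodule ℂ (ℕ → A) where
  carrier := {a | Summable fun n => star (a n) * a n}
  zero_mem' := by simp [summable_zero]
  add_mem' {a b} ha hb := by
    refine summable_of_le (fun n => star_mul_self_nonneg _) (fun n => star_add_mul_add_le _ _) ?_
    exact (ha.const_smul (2 : ℂ)).add (hb.const_smul (2 : ℂ))
  smul_mem' c a ha := by
    have h : (fun n => star ((c • a) n) * (c • a) n)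
        = fun n => (star c * c) • (star (a n) * a n) := by
      funext n
      simp [smul_mul_smul_comm]
    change Summable _
    rw [h]
    exact ha.const_smul _

/-- The generalized Hilbert space `ℓ²(A)`. -/
def EllTwo (A : Type*) [NonUnitalCStarAlgebra A] [PartialOrder A] [StarOrderedRing A] : Type _ :=
  ↥(ellTwoSubmodule A)

namespace EllTwo

noncomputable instance instAddCommGroup : AddCommGroup (EllTwo A) :=
  inferInstanceAs (AddCommGroup ↥(ellTwoSubmodule A))

noncomputable instance instModule : Module ℂ (EllTwo A) :=
  inferInstanceAs (Module ℂ ↥(ellTwoSubmodule A))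

/-- The `n`-th entry of a sequence in `ℓ²(A)`. -/
def entry (a : EllTwo A) (n : ℕ) : A := a.1 n

theorem ext {a b : EllTwo A} (h : ∀ n, a.entry n = b.entry n) : a = b :=
  Subtype.ext (funext h)

theorem entry_add (a b : EllTwo A) (n : ℕ) : (a + b).entry n = a.entry n + b.entry n := rfl

theorem entry_smul (c : ℂ) (a : EllTwo A) (n : ℕ) : (c • a).entry n = c • a.entry n := rfl

theorem entry_zero (n : ℕ) : (0 : EllTwo A).entry n = 0 := rfl

theorem summable (a : EllTwo A) : Summable fun n => star (a.entry n) * a.entry n := a.2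

theorem summable_mul (a b : EllTwo A) : Summable fun n => star (a.entry n) * b.entry n := by
  have h : (fun n => star (a.entry n) * b.entry n) = fun n =>
      (1 / 2 : ℂ) • (star ((a + b).entry n) * (a + b).entry n)
      - (Complex.I / 2) • (star ((a + Complex.I • b).entry n) * (a + Complex.I • b).entry n)
      - ((1 - Complex.I) / 2) • (star (a.entry n) * a.entry n)
      - ((1 - Complex.I) / 2) • (star (b.entry n) * b.entry n) := by
    funext n
    simp only [entry_add, entry_smul, star_add, star_smul, add_mul, mul_add, smul_mul_assoc,
      mul_smul_comm, smul_add, smul_smul]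
    have hI : star Complex.I = -Complex.I := Complex.conj_I
    rw [hI]
    have h1 : Complex.I / 2 * (Complex.I) = -1 / 2 := by
      rw [div_mul_eq_mul_div, Complex.I_mul_I]
    have h2 : Complex.I / 2 * (-Complex.I) = 1 / 2 := by
      rw [mul_neg, h1]; ring
    have h3 : Complex.I * (-Complex.I) = 1 := by
      rw [mul_neg, Complex.I_mul_I]; ring
    simp only [h1, h2, h3, mul_one]
    module
  rw [h]
  exact ((((a + b).summable.const_smul _).sub ((a + Complex.I • b).summable.const_smul _)).sub
    (a.summable.const_smul _)).sub (b.summable.const_smul _)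

/-- The right action `(aₙ) c = (aₙ c)`. -/
instance instSMulOp : SMul Aᵐᵒᵖ (EllTwo A) where
  smul c a := ⟨fun n => a.entry n * unop c, by
    have h : (fun n => star (a.entry n * unop c) * (a.entry n * unop c))
        = fun n => star (unop c) * (star (a.entry n) * a.entry n) * unop c := by
      funext n
      simp [mul_assoc]
    change Summable _
    rw [h]
    exact (a.summable.mul_left _).mul_right _⟩

theorem entry_op_smul (c : A) (a : EllTwo A) (n : ℕ) : (op c • a).entry n = a.entry n * c := rfl

/-- The inner product `⟨(aₙ), (bₙ)⟩ = ∑ aₙ* bₙ`. -/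
noncomputable instance instInner : Inner Aᵐᵒᵖ (EllTwo A) where
  inner a b := op (∑' n, star (a.entry n) * b.entry n)

theorem inner_eq (a b : EllTwo A) :
    inner Aᵐᵒᵖ a b = op (∑' n, star (a.entry n) * b.entry n) := rfl

/-- The norm `‖a‖ = ‖⟨a, a⟩‖ ^ (1/2)`. -/
noncomputable instance instNorm : Norm (EllTwo A) := CStarModule.norm Aᵐᵒᵖ

noncomputable instance instCStarModuleAux : CStarModule Aᵐᵒᵖ (EllTwo A) where
  inner_add_right {a b c} := by
    rw [inner_eq, inner_eq, inner_eq, ← op_add, ← (summable_mul a b).tsum_add (summable_mul a c)]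
    simp [entry_add, mul_add]
  inner_self_nonneg {a} := by
    change 0 ≤ unop (op _)
    exact tsum_nonneg fun n => star_mul_self_nonneg _
  inner_self {a} := by
    rw [inner_eq, op_eq_zero_iff]
    constructor
    · intro h
      have h1 := a.summable.hasSum
      rw [h] at h1
      rw [hasSum_zero_iff_of_nonneg (fun n => star_mul_self_nonneg _)] at h1
      exact EllTwo.ext fun n =>
        (CStarRing.star_mul_self_eq_zero_iff _).1 (congrFun h1 n)
    · rintro rfl
      simp [entry_zero]
  inner_op_smul_right {c a b} := by
    apply unop_injective
    rw [inner_eq, inner_eq, unop_mul, unop_op, unop_op, ← (summable_mul a b).tsum_mul_right]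
    refine tsum_congr fun n => ?_
    rw [mul_assoc]
    rfl
  inner_smul_right_complex {z a b} := by
    rw [inner_eq, inner_eq, ← op_smul, ← (summable_mul a b).tsum_const_smul]
    refine congrArg op (tsum_congr fun n => ?_)
    rw [entry_smul, mul_smul_comm]
  star_inner a b := by
    apply unop_injective
    rw [inner_eq, inner_eq, unop_star, unop_op, unop_op, tsum_star]
    simp
  norm_eq_sqrt_norm_inner_self a := rfl

noncomputable instance instNormedAddCommGroup : NormedAddCommGroup (EllTwo A) :=
  CStarModule.normedAddCommGroup Aᵐᵒᵖ

noncomputable instance instNormedSpace : NormedSpace ℂ (EllTwo A) :=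
  NormedSpace.ofCore (CStarModule.normedSpaceCore Aᵐᵒᵖ)

noncomputable instance instCStarModule : CStarModule Aᵐᵒᵖ (EllTwo A) :=
  instCStarModuleAux

theorem ip_eq (a b : EllTwo A) : ip A a b = ∑' n, star (a.entry n) * b.entry n := rfl

end EllTwo

end EllTwo

/-! ### Adjointable operators -/

/-- `𝔹(X, Y)`: operators `T : X → Y` together with an adjoint `T* : Y → X`, which is uniquely
determined by `T`.  Linearity and boundedness of both are recorded in the types; between Hilbert
modules they follow from the adjoint relation. -/
structure Adjointable (A : Type*) [NonUnitalCStarAlgebra A] [PartialOrder A]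
    (X : Type*) [NormedAddCommGroup X] [NormedSpace ℂ X] [SMul Aᵐᵒᵖ X] [CStarModule Aᵐᵒᵖ X]
    (Y : Type*) [NormedAddCommGroup Y] [NormedSpace ℂ Y] [SMul Aᵐᵒᵖ Y] [CStarModule Aᵐᵒᵖ Y] where
  toCLM : X →L[ℂ] Y
  adjCLM : Y →L[ℂ] X
  ip_adj : ∀ (x : X) (y : Y), ip A (toCLM x) y = ip A x (adjCLM y)

namespace Adjointable

variable {A : Type*} [NonUnitalCStarAlgebra A] [PartialOrder A]
variable {X : Type*} [NormedAddCommGroup X] [NormedSpace ℂ X] [SMul Aᵐᵒᵖ X] [CStarModule Aᵐᵒᵖ X]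
variable {Y : Type*} [NormedAddCommGroup Y] [NormedSpace ℂ Y] [SMul Aᵐᵒᵖ Y] [CStarModule Aᵐᵒᵖ Y]
variable {Z : Type*} [NormedAddCommGroup Z] [NormedSpace ℂ Z] [SMul Aᵐᵒᵖ Z] [CStarModule Aᵐᵒᵖ Z]

instance instCoeFun : CoeFun (Adjointable A X Y) fun _ => X → Y := ⟨fun T => T.toCLM⟩

theorem ext {S T : Adjointable A X Y} (h : ∀ x, S x = T x) : S = T := by
  obtain ⟨s, s', hs⟩ := S
  obtain ⟨t, t', ht⟩ := T
  obtain rfl : s = t := ContinuousLinearMap.ext h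
  obtain rfl : s' = t' := by
    ext y
    exact ext_ip (A := A) fun z => by rw [← hs, ← ht]
  rfl

/-- The adjoint `T*`. -/
def adjoint (T : Adjointable A X Y) : Adjointable A Y X where
  toCLM := T.adjCLM
  adjCLM := T.toCLM
  ip_adj y x := by rw [← star_ip, ← T.ip_adj, star_ip]

/-- The composition `S T`. -/
def comp (S : Adjointable A Y Z) (T : Adjointable A X Y) : Adjointable A X Z where
  toCLM := S.toCLM.comp T.toCLM
  adjCLM := T.adjCLM.comp S.adjCLM
  ip_adj x z := by
    rw [ContinuousLinearMap.comp_apply, ContinuousLinearMap.comp_apply, S.ip_adj, T.ip_adj]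

/-- The identity operator. -/
def one (A : Type*) [NonUnitalCStarAlgebra A] [PartialOrder A]
    (X : Type*) [NormedAddCommGroup X] [NormedSpace ℂ X] [SMul Aᵐᵒᵖ X] [CStarModule Aᵐᵒᵖ X] :
    Adjointable A X X where
  toCLM := ContinuousLinearMap.id ℂ X
  adjCLM := ContinuousLinearMap.id ℂ X
  ip_adj _ _ := rfl

/-- `S` is the two-sided inverse of `T` in `𝔹(X)`. -/
def IsInverse (S T : Adjointable A X X) : Prop :=
  S.comp T = one A X ∧ T.comp S = one A X

/-- The range `R(T)`. -/
def range (T : Adjointable A X Y) : Submodule ℂ Y := LinearMap.range (T.toCLM : X →ₗ[ℂ] Y)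

end Adjointable

/-! ### The multiplier module -/

section Multiplier

variable (A : Type*) [NonUnitalCStarAlgebra A] [PartialOrder A] [StarOrderedRing A]
variable (X : Type*) [NormedAddCommGroup X] [NormedSpace ℂ X] [SMul Aᵐᵒᵖ X] [CStarModule Aᵐᵒᵖ X]

/-- The multiplier module `M(X) = 𝔹(A, X)`.  For `v` in `M(X)`, `a` in `A` and `x` in `X`, the
product `v a` in `X` is `v a`, and the inner product `⟨v, x⟩` in `A` is `v* x`. -/
abbrev Multiplier : Type _ := Adjointable A A X

end Multiplier

section Frames

variable {A : Type*} [NonUnitalCStarAlgebra A] [PartialOrder A] [StarOrderedRing A]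
variable {X : Type*} [NormedAddCommGroup X] [NormedSpace ℂ X] [SMul Aᵐᵒᵖ X] [CStarModule Aᵐᵒᵖ X]

/-- The inner product `⟨v, x⟩` of `v` in `M(X)` with `x` in `X`. -/
def Multiplier.ip (v : Multiplier A X) (x : X) : A := v.adjoint x

/-- The canonical inclusion `X → M(X)`, `x ↦ (a ↦ x a)`, with `⟨x, ·⟩` as the adjoint. -/
noncomputable def Multiplier.ofElem (x : X) : Multiplier A X where
  toCLM := LinearMap.mkContinuous
    { toFun := fun a : A => op a • x
      map_add' := fun a b => ext_ip (A := A) fun z => by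
        simp only [ip_smul_right, ip_add_right, mul_add]
      map_smul' := fun c a => ext_ip (A := A) fun z => by
        simp only [ip_smul_right, ip_csmul_right, mul_smul_comm, RingHom.id_apply] } ‖x‖
    fun a => by
      refine le_of_sq_le_sq ?_ (by positivity)
      change ‖op a • x‖ ^ 2 ≤ _
      rw [norm_sq_eq_ip (A := A), ip_smul_right, ip_smul_left, mul_pow, norm_sq_eq_ip (A := A) x]
      calc ‖star a * ModularFrame.ip A x x * a‖
          ≤ ‖star a‖ * ‖ModularFrame.ip A x x‖ * ‖a‖ :=
            (norm_mul_le _ _).trans (mul_le_mul_of_nonneg_right (norm_mul_le _ _) (norm_nonneg _))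
        _ = ‖ModularFrame.ip A x x‖ * ‖a‖ ^ 2 := by rw [norm_star]; ring
  adjCLM := LinearMap.mkContinuous
    { toFun := fun y : X => ModularFrame.ip A x y
      map_add' := fun y z => ip_add_right x y z
      map_smul' := fun c y => ip_csmul_right x y c } ‖x‖
    fun y => by
      change ‖unop (inner Aᵐᵒᵖ x y)‖ ≤ _
      rw [norm_unop]
      exact CStarModule.norm_inner_le X
  ip_adj a y := ip_smul_left x y a

/-- `v` lies in `X`, regarded as a subset of `M(X)`. -/
def Multiplier.IsElem (v : Multiplier A X) : Prop := ∃ x : X, v = Multiplier.ofElem x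

/-- A frame for `X`: a sequence `(xₙ)` in `X` such that, for some constants `c, d > 0`,
`c ⟨z, z⟩ ≤ ∑ ⟨z, xₙ⟩ ⟨xₙ, z⟩ ≤ d ⟨z, z⟩` for all `z` in `X`, with convergence in norm. -/
def IsFrame (A : Type*) [NonUnitalCStarAlgebra A] [PartialOrder A]
    {X : Type*} [NormedAddCommGroup X] [NormedSpace ℂ X] [SMul Aᵐᵒᵖ X] [CStarModule Aᵐᵒᵖ X]
    (x : ℕ → X) : Prop :=
  ∃ c d : ℝ, 0 < c ∧ 0 < d ∧ ∀ z : X, ∃ s : A,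
    Tendsto (fun N => ∑ n ∈ Finset.range N, ip A z (x n) * ip A (x n) z) atTop (𝓝 s) ∧
    c • ip A z z ≤ s ∧ s ≤ d • ip A z z

/-- An outer frame for `X`: a sequence `(vₙ)` in `M(X)`, at least one member of which is not in
`X`, that satisfies the frame inequalities for all `z` in `X`; here `⟨z, vₙ⟩ = ⟨vₙ, z⟩*`. -/
def IsOuterFrame (v : ℕ → Multiplier A X) : Prop :=
  (∃ n, ¬ (v n).IsElem) ∧
  ∃ c d : ℝ, 0 < c ∧ 0 < d ∧ ∀ z : X, ∃ s : A,
    Tendsto (fun N => ∑ n ∈ Finset.range N, star ((v n).ip z) * (v n).ip z) atTop (𝓝 s) ∧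
    c • ip A z z ≤ s ∧ s ≤ d • ip A z z

/-- A sequence in `M(X)` that is a frame for `X` (all its members lie in `X` and form a frame) or
an outer frame for `X`. -/
def IsFrameOrOuterFrame (v : ℕ → Multiplier A X) : Prop :=
  (∃ x : ℕ → X, IsFrame A x ∧ ∀ n, v n = Multiplier.ofElem (x n)) ∨ IsOuterFrame v

/-- `U` is the analysis operator of `(vₙ)`: `U z = (⟨vₙ, z⟩)ₙ` for all `z` in `X`. -/
def IsAnalysisOperator (v : ℕ → Multiplier A X) (U : Adjointable A X (EllTwo A)) : Prop :=
  ∀ (z : X) (n : ℕ), (U z).entry n = (v n).ip z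

/-- `w` is dual to `v`: it is a frame or an outer frame, and `∑ wₙ ⟨vₙ, z⟩ = z` in norm for all
`z` in `X`. -/
def IsDual (v w : ℕ → Multiplier A X) : Prop :=
  IsFrameOrOuterFrame w ∧
  ∀ z : X, Tendsto (fun N => ∑ n ∈ Finset.range N, w n ((v n).ip z)) atTop (𝓝 z)

/-- `N` is a closed direct complement of `M` in the Hilbert module `X`: a closed submodule (over
`A`) with `X = M ∔ N`, not necessarily orthogonal to `M`. -/
def IsClosedDirectComplement (A : Type*) [NonUnitalCStarAlgebra A] [PartialOrder A]
    {X : Type*} [NormedAddCommGroup X] [NormedSpace ℂ X] [SMul Aᵐᵒᵖ X] [CStarModule Aᵐᵒᵖ X]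
    (M N : Submodule ℂ X) : Prop :=
  IsClosed (N : Set X) ∧ (∀ (a : A), ∀ x ∈ N, op a • x ∈ N) ∧ IsCompl M N

/-- Given `X = M ∔ N`, `F` is the oblique projection to `M` along `N`. -/
def IsObliqueProjection (F : Adjointable A X X) (M N : Submodule ℂ X) : Prop :=
  (∀ x ∈ M, F x = x) ∧ ∀ x ∈ N, F x = 0

end Frames

end ModularFrame

open ModularFrame

namespace ModularFrame

section InnerProduct

variable {A : Type*} [NonUnitalCStarAlgebra A] [PartialOrder A]
variable {X : Type*} [NormedAddCommGroup X] [NormedSpace ℂ X] [SMul Aᵐᵒᵖ X] [CStarModule Aᵐᵒᵖ X]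

theorem ip_zero_right (x : X) : ip A x (0 : X) = 0 := by
  simpa using ip_sub_right (A := A) x 0 0

theorem ip_sum_right {ι : Type*} (s : Finset ι) (x : X) (f : ι → X) :
    ip A x (∑ i ∈ s, f i) = ∑ i ∈ s, ip A x (f i) := by
  classical
  induction s using Finset.induction_on with
  | empty => simp [ip_zero_right]
  | insert i s hi ih => rw [Finset.sum_insert hi, Finset.sum_insert hi, ip_add_right, ih]

theorem ip_add_left (x y z : X) : ip A (x + y) z = ip A x z + ip A y z := by
  rw [← star_ip, ip_add_right, star_add, star_ip, star_ip]

theorem ip_sub_left (x y z : X) : ip A (x - y) z = ip A x z - ip A y z := by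
  rw [← star_ip, ip_sub_right, star_sub, star_ip, star_ip]

theorem ip_rsmul_right (r : ℝ) (x y : X) : ip A x (r • y) = r • ip A x y := by
  rw [← Complex.coe_smul, ip_csmul_right, Complex.coe_smul]

theorem ip_rsmul_left (r : ℝ) (x y : X) : ip A (r • x) y = r • ip A x y := by
  rw [← star_ip, ip_rsmul_right, star_smul, star_ip, star_trivial]

theorem ip_sum_left {ι : Type*} (s : Finset ι) (f : ι → X) (x : X) :
    ip A (∑ i ∈ s, f i) x = ∑ i ∈ s, ip A (f i) x := by
  rw [← star_ip, ip_sum_right, star_sum]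
  exact Finset.sum_congr rfl fun i _ => star_ip _ _

theorem ip_self_nonneg (x : X) : 0 ≤ ip A x x :=
  CStarModule.inner_self_nonneg (A := Aᵐᵒᵖ) (x := x)

theorem norm_ip_le [StarOrderedRing A] (x y : X) : ‖ip A x y‖ ≤ ‖x‖ * ‖y‖ := by
  rw [ip, norm_unop]
  exact CStarModule.norm_inner_le X

variable [StarOrderedRing A]

/-- A symmetric operator whose form lies between `0` and `q` has norm at most `q`. -/
theorem norm_apply_le_of_form_le (R : X →L[ℂ] X)
    (hR : ∀ x y, ip A (R x) y = ip A x (R y)) {q : ℝ} (hq : 0 < q)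
    (h0 : ∀ z, 0 ≤ ip A z (R z)) (h1 : ∀ z, ip A z (R z) ≤ q • ip A z z) (y : X) :
    ‖R y‖ ≤ q * ‖y‖ := by
  have key : 0 ≤ (2 * q) • (q ^ 2 • ip A y y - ip A (R y) (R y)) := by
    have e : (2 * q) • (q ^ 2 • ip A y y - ip A (R y) (R y)) =
        (q • ip A (R y + q • y) (R y + q • y) - ip A (R y + q • y) (R (R y + q • y)))
        + ip A (R y - q • y) (R (R y - q • y))
        + q • ip A (R y - q • y) (R y - q • y) := by
      have hs : R (q • y) = q • R y := by
        rw [← Complex.coe_smul, map_smul, Complex.coe_smul]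
      have h2 : ip A y (R (R y)) = ip A (R y) (R y) := (hR _ _).symm
      simp only [map_add, map_sub, hs, ip_add_right, ip_sub_right, ip_add_left, ip_sub_left,
        ip_rsmul_left, ip_rsmul_right, h2]
      module
    rw [e]
    exact add_nonneg (add_nonneg (sub_nonneg.2 (h1 _)) (h0 _))
      (smul_nonneg hq.le (ip_self_nonneg _))
  have h2 : ip A (R y) (R y) ≤ q ^ 2 • ip A y y := by
    have := smul_nonneg (inv_nonneg.2 (by positivity : (0 : ℝ) ≤ 2 * q)) key
    rw [smul_smul, inv_mul_cancel₀ (by positivity), one_smul] at this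
    exact sub_nonneg.1 this
  have h3 := CStarAlgebra.norm_le_norm_of_nonneg_of_le (ip_self_nonneg _) h2
  rw [norm_smul, ← norm_sq_eq_ip, ← norm_sq_eq_ip, Real.norm_of_nonneg (by positivity),
    ← mul_pow] at h3
  exact le_of_sq_le_sq h3 (by positivity)

/-- A symmetric contraction `R` satisfies `⟨z, R z⟩ ≤ ⟨z, z⟩`. -/
theorem ip_apply_le_of_contraction (R : X →L[ℂ] X)
    (hR : ∀ x y, ip A (R x) y = ip A x (R y)) (hc : ∀ z, ‖R z‖ ≤ ‖z‖) (z : X) :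
    ip A z (R z) ≤ ip A z z := by
  have iter : ∀ n : ℕ, ∃ a : A, ‖a‖ ≤ ((1 / 2 : ℝ) ^ n) * ‖z‖ ^ 2 ∧
      (1 - (1 / 2 : ℝ) ^ n) • ip A z z + a ≥ ip A z (R z) := by
    intro n
    induction n generalizing R with
    | zero =>
      refine ⟨ip A z (R z), ?_, by simp⟩
      calc ‖ip A z (R z)‖ ≤ ‖z‖ * ‖R z‖ := norm_ip_le _ _
        _ ≤ ‖z‖ * ‖z‖ := by gcongr; exact hc z
        _ = _ := by ring
    | succ n ih =>
      obtain ⟨a, ha, h⟩ := ih (R.comp R)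
        (fun x y => by
          rw [ContinuousLinearMap.comp_apply, ContinuousLinearMap.comp_apply, hR, hR])
        (fun z => (hc _).trans (hc z))
      refine ⟨(1 / 2 : ℝ) • a, ?_, ?_⟩
      · rw [norm_smul, Real.norm_of_nonneg (by norm_num), pow_succ]
        linarith
      · have h1 : 0 ≤ ip A (z - R z) (z - R z) := ip_self_nonneg _
        have h2 : 0 ≤ (1 / 2 : ℝ) • ip A (z - R z) (z - R z) :=
          smul_nonneg (by norm_num) h1
        have h3 := smul_nonneg (by norm_num : (0 : ℝ) ≤ 1 / 2) (sub_nonneg.2 h)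
        rw [ge_iff_le, ← sub_nonneg]
        convert add_nonneg h2 h3 using 1
        simp only [ip_sub_right, ip_sub_left, hR, ContinuousLinearMap.comp_apply, pow_succ]
        module
  choose a ha h using iter
  have hp : Tendsto (fun n : ℕ => (1 / 2 : ℝ) ^ n) atTop (𝓝 0) :=
    tendsto_pow_atTop_nhds_zero_of_lt_one (by norm_num) (by norm_num)
  have ha0 : Tendsto a atTop (𝓝 0) :=
    squeeze_zero_norm ha (by simpa using hp.mul_const (‖z‖ ^ 2))
  have hl : Tendsto (fun n : ℕ => (1 - (1 / 2 : ℝ) ^ n) • ip A z z + a n) atTop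
      (𝓝 (ip A z z)) := by
    simpa using ((hp.const_sub 1).smul_const (ip A z z)).add ha0
  exact ge_of_tendsto' hl h

end InnerProduct

namespace Adjointable

section

variable {A : Type*} [NonUnitalCStarAlgebra A] [PartialOrder A]
variable {X : Type*} [NormedAddCommGroup X] [NormedSpace ℂ X] [SMul Aᵐᵒᵖ X] [CStarModule Aᵐᵒᵖ X]
variable {Y : Type*} [NormedAddCommGroup Y] [NormedSpace ℂ Y] [SMul Aᵐᵒᵖ Y] [CStarModule Aᵐᵒᵖ Y]
variable {Z : Type*} [NormedAddCommGroup Z] [NormedSpace ℂ Z] [SMul Aᵐᵒᵖ Z] [CStarModule Aᵐᵒᵖ Z]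

theorem ip_adjoint (T : Adjointable A X Y) (x : X) (y : Y) :
    ip A (T x) y = ip A x (T.adjoint y) := T.ip_adj x y

theorem ip_adjoint' (T : Adjointable A X Y) (x : X) (y : Y) :
    ip A (T.adjoint y) x = ip A y (T x) := T.adjoint.ip_adj y x

theorem comp_apply (S : Adjointable A Y Z) (T : Adjointable A X Y) (x : X) :
    S.comp T x = S (T x) := rfl

theorem map_op_smul (T : Adjointable A X Y) (a : A) (x : X) : T (op a • x) = op a • T x :=
  ext_ip (A := A) fun z => by
    rw [ip_smul_right, ← T.ip_adjoint', ← T.ip_adjoint', ip_smul_right]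

variable [StarOrderedRing A]

/-- The operator determined by a bounded operator and a map that is formally adjoint to it. -/
noncomputable def ofFormalAdjoint (T : X →L[ℂ] Y) (T' : Y → X)
    (h : ∀ x y, ip A (T x) y = ip A x (T' y)) : Adjointable A X Y where
  toCLM := T
  adjCLM := LinearMap.mkContinuous
    { toFun := T'
      map_add' := fun y z => ext_ip (A := A) fun x => by
        simp only [ip_add_right, ← h]
      map_smul' := fun c y => ext_ip (A := A) fun x => by
        simp only [ip_csmul_right, ← h, RingHom.id_apply] } ‖T‖
    fun y => by
      change ‖T' y‖ ≤ _
      rcases (norm_nonneg (T' y)).eq_or_lt with h0 | h0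
      · rw [← h0]; positivity
      refine le_of_mul_le_mul_right ?_ h0
      calc ‖T' y‖ * ‖T' y‖ = ‖ip A (T (T' y)) y‖ := by rw [h, ← norm_sq_eq_ip, sq]
        _ ≤ ‖T (T' y)‖ * ‖y‖ := norm_ip_le _ _
        _ ≤ ‖T‖ * ‖T' y‖ * ‖y‖ := by gcongr; exact T.le_opNorm _
        _ = _ := by ring
  ip_adj := h

/-- An adjointable operator satisfies `⟨T z, T z⟩ ≤ K ⟨z, z⟩` for some constant `K`. -/
theorem exists_ip_apply_le (T : Adjointable A X Y) :
    ∃ K : ℝ, 0 < K ∧ ∀ z, ip A (T z) (T z) ≤ K • ip A z z := by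
  set P : X →L[ℂ] X := T.adjCLM.comp T.toCLM with hP
  have hPs : ∀ x y, ip A (P x) y = ip A x (P y) := fun x y => by
    change ip A (T.adjoint (T x)) y = ip A x (T.adjoint (T y))
    rw [ip_adjoint', ip_adjoint]
  set K : ℝ := ‖P‖ + 1 with hK
  have hK0 : 0 < K := by positivity
  refine ⟨K, hK0, fun z => ?_⟩
  have h := ip_apply_le_of_contraction (A := A) (((K⁻¹ : ℝ) : ℂ) • P)
    (fun x y => by
      simp only [_root_.smul_apply, Complex.coe_smul, ip_rsmul_left, ip_rsmul_right,
        hPs])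
    (fun z => by
      rw [_root_.smul_apply, Complex.coe_smul, norm_smul,
        Real.norm_of_nonneg (by positivity), inv_mul_le_iff₀ hK0]
      refine (P.le_opNorm z).trans ?_
      gcongr
      linarith) z
  rw [_root_.smul_apply, Complex.coe_smul, ip_rsmul_right] at h
  have h2 := smul_le_smul_of_nonneg_left h hK0.le
  rw [smul_smul, mul_inv_cancel₀ hK0.ne', one_smul] at h2
  rw [T.ip_adjoint]
  exact h2

/-- A symmetric operator whose form is bounded below and above by positive multiples of the inner
product is invertible. -/
theorem exists_isInverse_of_form_bounds [CompleteSpace X] (T : Adjointable A X X)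
    (hT : ∀ x y, ip A (T x) y = ip A x (T y)) {c d : ℝ} (hc : 0 < c) (hd : 0 < d)
    (h1 : ∀ z, c • ip A z z ≤ ip A z (T z)) (h2 : ∀ z, ip A z (T z) ≤ d • ip A z z) :
    ∃ S : Adjointable A X X, S.IsInverse T := by
  set r : ℝ := (c + d)⁻¹ with hr
  have hr0 : 0 < r := by positivity
  have hrcd : r * c + r * d = 1 := by rw [hr]; field_simp
  set R : X →L[ℂ] X := 1 - (r : ℂ) • T.toCLM with hRdef
  have hRa : ∀ z, R z = z - r • T z := fun z => by
    rw [hRdef, ← Complex.coe_smul]; rfl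
  have hform : ∀ z, ip A z (R z) = ip A z z - r • ip A z (T z) := fun z => by
    rw [hRa, ip_sub_right, ip_rsmul_right]
  have hRnorm : ‖R‖ ≤ r * d := by
    refine R.opNorm_le_bound (by positivity) ?_
    refine norm_apply_le_of_form_le (A := A) R ?_ (by positivity) ?_ ?_
    · intro x y
      rw [hRa, hRa, ip_sub_left, ip_sub_right, ip_rsmul_left, ip_rsmul_right, hT]
    · intro z
      rw [hform, sub_nonneg]
      refine (smul_le_smul_of_nonneg_left (h2 z) hr0.le).trans ?_
      rw [smul_smul, ← sub_nonneg]
      have : ip A z z - (r * d) • ip A z z = (r * c) • ip A z z := by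
        rw [← sub_eq_of_eq_add' hrcd.symm]; module
      rw [this]
      exact smul_nonneg (by positivity) (ip_self_nonneg _)
    · intro z
      rw [hform, sub_le_iff_le_add]
      have := smul_le_smul_of_nonneg_left (h1 z) hr0.le
      rw [smul_smul] at this
      calc ip A z z = (r * d) • ip A z z + (r * c) • ip A z z := by
            rw [← add_smul, add_comm, hrcd, one_smul]
        _ ≤ _ := by gcongr
  have hu : IsUnit (1 - R) := isUnit_one_sub_of_norm_lt_one
    (hRnorm.trans_lt (by nlinarith [mul_pos hr0 hc]))
  have hTR : ∀ z, (1 - R) z = r • T z := fun z => by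
    change z - R z = _
    rw [hRa]; abel
  obtain ⟨W, hW1, hW2⟩ := isUnit_iff_exists.1 hu
  have hTW : ∀ z, T ((r : ℂ) • W z) = z := fun z => by
    have := congrArg (fun L : X →L[ℂ] X => L z) hW1
    change (1 - R) (W z) = z at this
    rw [map_smul, Complex.coe_smul, ← hTR, this]
  have hWT : ∀ z, (r : ℂ) • W (T z) = z := fun z => by
    have := congrArg (fun L : X →L[ℂ] X => L z) hW2
    change W ((1 - R) z) = z at this
    rw [← map_smul, Complex.coe_smul, ← hTR, this]
  refine ⟨⟨(r : ℂ) • W, (r : ℂ) • W, fun x y => ?_⟩, ?_, ?_⟩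
  · change ip A ((r : ℂ) • W x) y = ip A x ((r : ℂ) • W y)
    conv_lhs => rw [← hTW y, ← hT, hTW x]
  · exact ext hWT
  · exact ext hTW

end

end Adjointable

namespace EllTwo

variable {A : Type*} [NonUnitalCStarAlgebra A] [PartialOrder A] [StarOrderedRing A]

theorem entry_sum {ι : Type*} (s : Finset ι) (f : ι → EllTwo A) (n : ℕ) :
    (∑ i ∈ s, f i).entry n = ∑ i ∈ s, (f i).entry n := by
  classical
  induction s using Finset.induction_on with
  | empty => simp [entry_zero]
  | insert i s hi ih => rw [Finset.sum_insert hi, Finset.sum_insert hi, entry_add, ih]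

/-- The sequence with entry `a` at `n` and `0` elsewhere. -/
def singleVec (n : ℕ) (a : A) : EllTwo A :=
  ⟨Pi.single n a, summable_of_ne_finset_zero (s := {n}) fun k hk => by
    rw [Finset.mem_singleton] at hk
    simp [Pi.single_eq_of_ne hk]⟩

theorem entry_singleVec (n : ℕ) (a : A) (k : ℕ) :
    (singleVec n a).entry k = (Pi.single n a : ℕ → A) k := rfl

theorem ip_singleVec (n : ℕ) (a : A) (b : EllTwo A) :
    ip A (singleVec n a) b = star a * b.entry n := by
  rw [ip_eq, tsum_eq_single n fun k hk => by
    rw [entry_singleVec, Pi.single_eq_of_ne hk, star_zero, zero_mul],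
    entry_singleVec, Pi.single_eq_same]

theorem norm_singleVec (n : ℕ) (a : A) : ‖singleVec n a‖ = ‖a‖ := by
  refine (pow_left_inj₀ (norm_nonneg _) (norm_nonneg _) two_ne_zero).1 ?_
  rw [norm_sq_eq_ip (A := A), ip_singleVec, entry_singleVec, Pi.single_eq_same,
    CStarRing.norm_star_mul_self, sq]

/-- The inclusion of `A` into `ℓ²(A)` as the `n`-th coordinate, with `entry n` as its adjoint. -/
noncomputable def single (n : ℕ) : Adjointable A A (EllTwo A) :=
  Adjointable.ofFormalAdjoint
    (LinearMap.mkContinuous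
      { toFun := singleVec n
        map_add' := fun a b => EllTwo.ext fun k => by
          simp only [entry_add, entry_singleVec, Pi.single_add, Pi.add_apply]
        map_smul' := fun c a => EllTwo.ext fun k => by
          simp only [entry_smul, entry_singleVec, Pi.single_smul, Pi.smul_apply,
            RingHom.id_apply] } 1
      fun a => by
        rw [one_mul]
        exact (norm_singleVec n a).le)
    (fun b => b.entry n) fun a b => ip_singleVec n a b

theorem single_apply (n : ℕ) (a : A) : single n a = singleVec n a := rfl

theorem hasSum_single (a : EllTwo A) : HasSum (fun n => single n (a.entry n)) a := by
  have key : ∀ s : Finset ℕ, ‖(∑ n ∈ s, single n (a.entry n)) - a‖ ^ 2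
      = ‖ip A a a - ∑ n ∈ s, star (a.entry n) * a.entry n‖ := by
    intro s
    set p : EllTwo A := ∑ n ∈ s, single n (a.entry n) with hp
    have hpe : ∀ k ∈ s, p.entry k = a.entry k := fun k hk => by
      rw [hp, entry_sum, Finset.sum_eq_single_of_mem k hk]
      · rw [single_apply, entry_singleVec, Pi.single_eq_same]
      · intro n _ hn
        rw [single_apply, entry_singleVec, Pi.single_eq_of_ne hn.symm]
    have h1 : ∀ b : EllTwo A, ip A p b = ∑ n ∈ s, star (a.entry n) * b.entry n := fun b => by
      rw [hp, ip_sum_left]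
      exact Finset.sum_congr rfl fun n _ => ip_singleVec _ _ _
    have h2 : ip A p p = ∑ n ∈ s, star (a.entry n) * a.entry n := by
      rw [h1]
      exact Finset.sum_congr rfl fun n hn => by rw [hpe n hn]
    have h3 : ip A a p = ∑ n ∈ s, star (a.entry n) * a.entry n := by
      rw [← star_ip, h1, star_sum]
      exact Finset.sum_congr rfl fun n _ => by rw [star_mul, star_star]
    rw [norm_sq_eq_ip (A := A)]
    simp only [ip_sub_left, ip_sub_right, h2, h3, h1 a]
    congr 1
    abel
  have h := a.summable.hasSum
  rw [← ip_eq] at h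
  have h0 : Tendsto (fun s : Finset ℕ => ‖(∑ n ∈ s, single n (a.entry n)) - a‖ ^ 2)
      atTop (𝓝 0) := by
    simp only [key]
    have := (tendsto_const_nhds (x := ip A a a)).sub h
    rw [sub_self] at this
    exact tendsto_zero_iff_norm_tendsto_zero.1 this
  rw [HasSum, SummationFilter.unconditional_filter, tendsto_iff_norm_sub_tendsto_zero]
  have h4 := (Real.continuous_sqrt.tendsto 0).comp h0
  simpa [Function.comp_def, Real.sqrt_sq] using h4

end EllTwo

section Frames

variable {A : Type*} [NonUnitalCStarAlgebra A] [PartialOrder A] [StarOrderedRing A]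
variable {X : Type*} [NormedAddCommGroup X] [NormedSpace ℂ X] [SMul Aᵐᵒᵖ X] [CStarModule Aᵐᵒᵖ X]

theorem Multiplier.ip_ofElem (x z : X) : (Multiplier.ofElem (A := A) x).ip z = ModularFrame.ip A x z := rfl

theorem isFrameOrOuterFrame_iff (v : ℕ → Multiplier A X) :
    IsFrameOrOuterFrame v ↔ ∃ c d : ℝ, 0 < c ∧ 0 < d ∧ ∀ z : X, ∃ s : A,
      HasSum (fun n => star ((v n).ip z) * (v n).ip z) s ∧
      c • ip A z z ≤ s ∧ s ≤ d • ip A z z := by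
  have conv : ∀ (z : X) (s : A), HasSum (fun n => star ((v n).ip z) * (v n).ip z) s ↔
      Tendsto (fun N => ∑ n ∈ Finset.range N, star ((v n).ip z) * (v n).ip z) atTop (𝓝 s) := by
    intro z s
    refine ⟨fun h => h.tendsto_sum_nat, fun h => ?_⟩
    have hs := (summable_iff_tendsto fun n => star_mul_self_nonneg ((v n).ip z)).2 ⟨s, h⟩
    rw [tendsto_nhds_unique h hs.hasSum.tendsto_sum_nat]
    exact hs.hasSum
  simp only [conv]
  constructor
  · rintro (⟨y, ⟨c, d, hc, hd, h⟩, hv⟩ | ⟨-, h⟩)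
    · refine ⟨c, d, hc, hd, fun z => ?_⟩
      obtain ⟨s, hs, h1, h2⟩ := h z
      refine ⟨s, ?_, h1, h2⟩
      simpa only [hv, Multiplier.ip_ofElem, star_ip] using hs
    · exact h
  · intro h
    by_cases he : ∀ n, (v n).IsElem
    · choose y hy using he
      refine Or.inl ⟨y, ?_, hy⟩
      simpa only [IsFrame, hy, Multiplier.ip_ofElem, star_ip] using h
    · exact Or.inr ⟨not_forall.1 he, h⟩

/-- The analysis operator of a sequence that satisfies the upper frame inequality. -/
theorem exists_isAnalysisOperator [CompleteSpace X] (v : ℕ → Multiplier A X) {d : ℝ} (hd : 0 < d)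
    (h : ∀ z : X, ∃ s : A, HasSum (fun n => star ((v n).ip z) * (v n).ip z) s ∧
      s ≤ d • ip A z z) :
    ∃ U : Adjointable A X (EllTwo A), IsAnalysisOperator v U := by
  let U₀ : X → EllTwo A := fun z => ⟨fun n => (v n).ip z, (h z).choose_spec.1.summable⟩
  have hU₀ : ∀ z n, (U₀ z).entry n = (v n).ip z := fun _ _ => rfl
  have hbound : ∀ z, ‖U₀ z‖ ≤ √d * ‖z‖ := fun z => by
    obtain ⟨s, hs, hle⟩ := h z
    have hsum : ip A (U₀ z) (U₀ z) = s := by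
      rw [EllTwo.ip_eq]
      exact hs.tsum_eq
    refine le_of_sq_le_sq ?_ (by positivity)
    rw [← hsum] at hle
    have := CStarAlgebra.norm_le_norm_of_nonneg_of_le (ip_self_nonneg _) hle
    rwa [norm_smul, ← norm_sq_eq_ip, ← norm_sq_eq_ip, Real.norm_of_nonneg hd.le,
      ← Real.sq_sqrt hd.le, ← mul_pow] at this
  let U : X →L[ℂ] EllTwo A := LinearMap.mkContinuous
    { toFun := U₀
      map_add' := fun y z => EllTwo.ext fun n => by
        simp only [EllTwo.entry_add, hU₀]
        exact map_add (v n).adjCLM y z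
      map_smul' := fun c z => EllTwo.ext fun n => by
        simp only [EllTwo.entry_smul, hU₀]
        exact map_smul (v n).adjCLM c z } √d hbound
  have hterm : ∀ (n : ℕ) (a : A) (z : X),
      ip A (v n a) z = ip A (EllTwo.single n a) (U z) := fun n a z => by
    rw [EllTwo.single_apply, EllTwo.ip_singleVec, Adjointable.ip_adjoint]
    rfl
  have hsumm : ∀ a : EllTwo A, Summable fun n => v n (a.entry n) := fun a => by
    rw [summable_iff_vanishing_norm]
    intro ε hε
    have hcs := Tendsto.cauchySeq (EllTwo.hasSum_single a)
    rw [cauchySeq_finset_iff_vanishing_norm] at hcs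
    obtain ⟨s, hs⟩ := hcs (ε / (‖U‖ + 1)) (by positivity)
    refine ⟨s, fun t ht => ?_⟩
    have h1 := hs t ht
    rw [lt_div_iff₀ (by positivity)] at h1
    set w := ∑ n ∈ t, v n (a.entry n) with hw
    set e := ∑ n ∈ t, EllTwo.single n (a.entry n) with he
    refine lt_of_le_of_lt ?_ h1
    rcases (norm_nonneg w).eq_or_lt with h0 | h0
    · rw [← h0]; positivity
    refine le_of_mul_le_mul_right ?_ h0
    have h2 : ip A w w = ip A e (U w) := by
      conv_lhs => rw [hw, ip_sum_left]
      rw [he, ip_sum_left]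
      exact Finset.sum_congr rfl fun n _ => hterm _ _ _
    calc ‖w‖ * ‖w‖ = ‖ip A e (U w)‖ := by rw [← h2, ← norm_sq_eq_ip, sq]
      _ ≤ ‖e‖ * ‖U w‖ := norm_ip_le _ _
      _ ≤ ‖e‖ * (‖U‖ * ‖w‖) := by gcongr; exact U.le_opNorm _
      _ ≤ ‖e‖ * ((‖U‖ + 1) * ‖w‖) := by gcongr; linarith
      _ = _ := by ring
  refine ⟨Adjointable.ofFormalAdjoint U (fun a => ∑' n, v n (a.entry n)) fun z a => ?_,
    fun z n => rfl⟩
  have h1 := (hsumm a).hasSum.map (Multiplier.ofElem (A := A) z).adjCLM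
    (Multiplier.ofElem (A := A) z).adjCLM.continuous
  have h2 := (EllTwo.hasSum_single a).map (Multiplier.ofElem (A := A) (U z)).adjCLM
    (Multiplier.ofElem (A := A) (U z)).adjCLM.continuous
  refine h2.unique ?_
  convert h1 using 1
  · funext n
    symm
    change ip A z (v n (a.entry n)) = ip A (U z) (EllTwo.single n (a.entry n))
    rw [← star_ip, hterm, star_ip]
  · rfl

theorem IsAnalysisOperator.hasSum_ip {v : ℕ → Multiplier A X} {U : Adjointable A X (EllTwo A)}
    (hU : IsAnalysisOperator v U) (z : X) :
    HasSum (fun n => star ((v n).ip z) * (v n).ip z) (ip A (U z) (U z)) := by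
  have := (U z).summable.hasSum
  simp only [hU z] at this
  rw [EllTwo.ip_eq]
  simpa only [hU z] using this

/-- The synthesis formula `U* a = ∑ vₙ aₙ`. -/
theorem IsAnalysisOperator.hasSum_adjoint {v : ℕ → Multiplier A X}
    {U : Adjointable A X (EllTwo A)} (hU : IsAnalysisOperator v U) (a : EllTwo A) :
    HasSum (fun n => v n (a.entry n)) (U.adjoint a) := by
  have h := (EllTwo.hasSum_single a).map U.adjCLM U.adjCLM.continuous
  convert h using 1
  · funext n
    symm
    refine ext_ip (A := A) fun z => ?_
    change ip A z (U.adjoint (EllTwo.single n (a.entry n))) = _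
    rw [← U.ip_adjoint, ← star_ip (EllTwo.single n (a.entry n)), EllTwo.single_apply,
      EllTwo.ip_singleVec, hU, ← star_ip (v n _), Adjointable.ip_adjoint]
    rfl
  · rfl

/-- Every adjointable operator into `ℓ²(A)` is the analysis operator of a sequence in `M(X)`. -/
theorem isAnalysisOperator_comp_single (V : Adjointable A X (EllTwo A)) :
    IsAnalysisOperator (fun n => V.adjoint.comp (EllTwo.single n)) V :=
  fun _ _ => rfl

/-- A sequence with analysis operator `V` is dual to one with analysis operator `U` if and only if
`V* U = 1`. -/
theorem isDual_iff {x y : ℕ → Multiplier A X} {U V : Adjointable A X (EllTwo A)}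
    (hU : IsAnalysisOperator x U) (hV : IsAnalysisOperator y V) :
    IsDual x y ↔ ∀ z, V.adjoint (U z) = z := by
  have hsum : ∀ z, HasSum (fun n => y n ((x n).ip z)) (V.adjoint (U z)) := fun z => by
    simpa only [hU z] using hV.hasSum_adjoint (U z)
  constructor
  · rintro ⟨-, h⟩ z
    exact tendsto_nhds_unique (hsum z).tendsto_sum_nat (h z)
  · intro h
    refine ⟨(isFrameOrOuterFrame_iff y).2 ?_, fun z => ?_⟩
    · obtain ⟨d, hd, hVd⟩ := V.exists_ip_apply_le
      obtain ⟨k, hk, hUk⟩ := U.adjoint.exists_ip_apply_le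
      refine ⟨k⁻¹, d, inv_pos.2 hk, hd, fun z => ⟨_, hV.hasSum_ip z, ?_, hVd z⟩⟩
      have h1 : U.adjoint (V z) = z := ext_ip (A := A) fun w => by
        rw [← U.ip_adjoint, ← V.ip_adjoint', h]
      have h2 := smul_le_smul_of_nonneg_left (hUk (V z)) (inv_nonneg.2 hk.le)
      rwa [h1, smul_smul, inv_mul_cancel₀ hk.ne', one_smul] at h2
    · simpa only [h z] using (hsum z).tendsto_sum_nat

/-- If `V* U = 1`, then `U V*` is the oblique projection to the range of `U` along the kernel
of `V*`. -/
theorem isObliqueProjection_comp_adjoint {U V : Adjointable A X (EllTwo A)}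
    (h : ∀ z, V.adjoint (U z) = z) :
    ∃ N : Submodule ℂ (EllTwo A), IsClosedDirectComplement A U.range N ∧
      IsObliqueProjection (U.comp V.adjoint) U.range N := by
  refine ⟨LinearMap.ker (V.adjCLM : EllTwo A →ₗ[ℂ] X), ⟨?_, ?_, ?_⟩, ?_, ?_⟩
  · exact V.adjCLM.isClosed_ker
  · intro a w hw
    have hw : V.adjoint w = 0 := hw
    change V.adjoint (op a • w) = 0
    rw [V.adjoint.map_op_smul, hw]
    exact ext_ip (A := A) fun z => by simp [ip_smul_right, ip_zero_right]
  · rw [isCompl_iff, Submodule.disjoint_def, codisjoint_iff, Submodule.eq_top_iff']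
    refine ⟨?_, fun w => ?_⟩
    · rintro _ ⟨z, rfl⟩ hz
      have hz : V.adjoint (U z) = 0 := hz
      rw [h] at hz
      rw [hz, map_zero]
    · refine Submodule.mem_sup.2 ⟨U (V.adjoint w), ⟨_, rfl⟩, w - U (V.adjoint w), ?_, by abel⟩
      change V.adjoint (w - U (V.adjoint w)) = 0
      rw [map_sub, h, sub_self]
  · rintro _ ⟨z, rfl⟩
    exact congrArg U.toCLM (h z)
  · intro w hw
    have hw : V.adjoint w = 0 := hw
    rw [Adjointable.comp_apply, hw, map_zero]

end Frames

end ModularFrame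

open ModularFrame
theorem theorem4p11 {A : Type*} [NonUnitalCStarAlgebra A] [PartialOrder A] [StarOrderedRing A]
    {X : Type*} [NormedAddCommGroup X] [NormedSpace ℂ X] [CompleteSpace X]
    [SMul Aᵐᵒᵖ X] [CStarModule Aᵐᵒᵖ X]
    (x : ℕ → Multiplier A X) (hx : IsFrameOrOuterFrame x) :
    ∃ (U : Adjointable A X (EllTwo A)) (S : Adjointable A X X),
      IsAnalysisOperator x U ∧ S.IsInverse (U.adjoint.comp U) ∧
      ∀ V : Adjointable A X (EllTwo A),
        (∃ y : ℕ → Multiplier A X, IsDual x y ∧ IsAnalysisOperator y V) ↔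
        ∃ F : Adjointable A (EllTwo A) (EllTwo A),
          (∃ N : Submodule ℂ (EllTwo A),
            IsClosedDirectComplement A U.range N ∧ IsObliqueProjection F U.range N) ∧
          V = (F.adjoint.comp U).comp S := by
  obtain ⟨c, d, hc, hd, h⟩ := (isFrameOrOuterFrame_iff x).1 hx
  obtain ⟨U, hU⟩ := exists_isAnalysisOperator x hd fun z =>
    let ⟨s, hs, _, h2⟩ := h z
    ⟨s, hs, h2⟩
  have hform : ∀ z, c • ip A z z ≤ ip A z (U.adjoint.comp U z) ∧
      ip A z (U.adjoint.comp U z) ≤ d • ip A z z := fun z => by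
    obtain ⟨s, hs, h12⟩ := h z
    rw [Adjointable.comp_apply, ← U.ip_adjoint, (hU.hasSum_ip z).unique hs]
    exact h12
  obtain ⟨S, hS⟩ := Adjointable.exists_isInverse_of_form_bounds (U.adjoint.comp U)
    (fun y z => by
      rw [Adjointable.comp_apply, Adjointable.comp_apply, U.ip_adjoint', U.ip_adjoint])
    hc hd (fun z => (hform z).1) fun z => (hform z).2
  have hTS : ∀ z, U.adjoint (U (S z)) = z := fun z =>
    congrArg (fun T : Adjointable A X X => T z) hS.2
  refine ⟨U, S, hU, hS, fun V => ⟨?_, ?_⟩⟩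
  · rintro ⟨y, hy, hV⟩
    refine ⟨U.comp V.adjoint, isObliqueProjection_comp_adjoint ((isDual_iff hU hV).1 hy), ?_⟩
    refine Adjointable.ext fun z => ?_
    change V z = V (U.adjoint (U (S z)))
    rw [hTS]
  · rintro ⟨F, ⟨N, -, hF, -⟩, rfl⟩
    refine ⟨_, (isDual_iff hU (isAnalysisOperator_comp_single _)).2 fun z => ?_,
      isAnalysisOperator_comp_single _⟩
    refine ext_ip (A := A) fun w => ?_
    rw [← Adjointable.ip_adjoint, Adjointable.comp_apply, Adjointable.comp_apply,
      F.ip_adjoint', hF (U z) ⟨z, rfl⟩, ← U.ip_adjoint', hTS]
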